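/- Let $m\ge 1$, $d=2^m$, and let $\rho$ be a state of $m$ qubits, i.e. a positive semidefinite complex $d\times d$ matrix with $\operatorname{tr}\rho=1$. Let $X_1,X_2,\dots$ be independent random operators, each uniformly distributed on the set of the $d^2-1$ Pauli operators $P_1\otimes\cdots\otimes P_m\neq I$ with $P_k\in\{I,\sigma_x,\sigma_y,\sigma_z\}$. Fix a learning rate $0<\eta<\frac12$ and a positive definite initial estimate $\hat\rho_1$ with $\operatorname{tr}\hat\rho_1=1$ (for instance the completely mixed state $\hat\rho_1=\frac1d I$), and define the matrix-exponentiated gradient (MEG) estimates from the noiseless measurement outcomes $y_t=\operatorname{tr}(\rho X_t)$ by $$\hat\rho_{t+1}=\frac{\exp(G_{t+1})}{\operatorname{tr}\exp(G_{t+1})},\qquad G_{t+1}=\log(\hat\rho_t)-2\eta\,\bigl(\operatorname{tr}(\hat\rho_tX_t)-y_t\bigr)X_t,\qquad t\ge 1.$$ Then $\hat\rho_t$ converges in probability to the true state $\rho$: for every $\delta>0$, $$\lim_{t\to\infty}\Pr\bigl\{\|\hat\rho_t-\rho\|_F^2<\delta\bigr\}=1,$$ where $\|\cdot\|_F$ is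 the Frobenius norm. -/

import Mathlib

open MeasureTheory ProbabilityTheory Filter Topology
open scoped ComplexOrder

/-- Operators on `m` qubits: complex matrices of dimension `d = 2 ^ m`, whose rows and columns are
indexed by the computational basis. -/
abbrev QubitOp (m : ℕ) : Type := Matrix (Fin m → Fin 2) (Fin m → Fin 2) ℂ

/-- The single-qubit operators `I, σ_x, σ_y, σ_z`. -/
def pauli : Fin 4 → Matrix (Fin 2) (Fin 2) ℂ :=
  ![1, !![0, 1; 1, 0], !![0, -Complex.I; Complex.I, 0], !![1, 0; 0, -1]]

/-- The `m`-qubit Pauli operator `pauli (p 0) ⊗ ⋯ ⊗ pauli (p (m - 1))`, by its matrix entries. -/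
def pauliOp {m : ℕ} (p : Fin m → Fin 4) : QubitOp m :=
  Matrix.of fun a b => ∏ k, pauli (p k) (a k) (b k)

/-- Labels of the `d ^ 2 - 1 = 4 ^ m - 1` Pauli operators other than the identity
(the identity operator has label `0`). -/
abbrev NonIdPauli (m : ℕ) : Type := {p : Fin m → Fin 4 // p ≠ 0}

/-- Quantum states: positive semidefinite operators of unit trace. -/
def IsState {m : ℕ} (ρ : QubitOp m) : Prop := ρ.PosSemidef ∧ ρ.trace = 1

open scoped Matrix.Norms.Frobenius in
/-- The Frobenius norm. -/
noncomputable def frobeniusNorm {m : ℕ} (A : QubitOp m) : ℝ := ‖A‖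

/-- The exponent `log σ - 2 η (tr (σ X) - y) X` of the matrix-exponentiated gradient rule. The
logarithm is that of the Hermitian functional calculus, and `tr (σ X)` is real for Hermitian
`σ` and `X`. -/
noncomputable def megExponent {m : ℕ} (η : ℝ) (σ X : QubitOp m) (y : ℝ) : QubitOp m :=
  cfc Real.log σ - (2 * η * ((σ * X).trace.re - y)) • X

/-- The matrix-exponentiated gradient update `exp G / tr (exp G)` with `G` as above. -/
noncomputable def megUpdate {m : ℕ} (η : ℝ) (σ X : QubitOp m) (y : ℝ) : QubitOp m :=
  (NormedSpace.exp (megExponent η σ X y)).trace⁻¹ • NormedSpace.exp (megExponent η σ X y)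

/-- The running estimate from noiseless measurements of the true state `ρ`, with constant learning
rate `η` and initial estimate `σ`, when the Pauli operator with label `x t` is measured in step `t`
and gives the outcome `tr (ρ X_t)`. Steps are counted from `0`: the value at `t` is the estimate
available before step `t`, so the value at `0` is the initial estimate. -/
noncomputable def megEstimate {m : ℕ} (η : ℝ) (ρ σ : QubitOp m) (x : ℕ → NonIdPauli m) :
    ℕ → QubitOp m
  | 0 => σ
  | t + 1 => megUpdate η (megEstimate η ρ σ x t) (pauliOp (x t).1) (ρ * pauliOp (x t).1).trace.re

/-! The potential is `tr (ρ log σ_t)`, which is the negative relative entropy from `ρ` up to a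
constant. It is never positive, and each step raises it by at least `2η(1-η)` times the squared
prediction error (`le_trace_mul_log_megUpdate_sub`), which rests on a quantum Pinsker inequality for
one unitary observable. Hence the squared errors have a bounded sum along every measurement sequence
(`sum_sq_prediction_error_le`).

The next Pauli label is uniform and independent of the current estimate, and the Paulis form an
orthogonal basis. The expected squared error is therefore a fixed positive multiple of `E ‖σ_t -
ρ‖_F²`. These expectations are summable, so they tend to `0`, and Markov's inequality gives
convergence in probability. -/

/-! ### Scalar inequalities behind Pinsker -/

theorem Real.le_log_of_pos {t : ℝ} (ht : 0 < t) :
    (5 * t ^ 2 - 4 * t - 1) / (2 * t ^ 2 + 4 * t) ≤ Real.log t := by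
  set g : ℝ → ℝ := fun t => Real.log t - (5 * t ^ 2 - 4 * t - 1) / (2 * t ^ 2 + 4 * t) with hg
  -- The derivative has the sign of `x - 1`, so `g` is minimal at `1`, where it vanishes.
  have hd : ∀ x : ℝ, 0 < x → HasDerivAt g ((x - 1) ^ 3 / (x ^ 2 * (x + 2) ^ 2)) x := by
    intro x hx
    have h1 : HasDerivAt (fun t : ℝ => 5 * t ^ 2 - 4 * t - 1) (10 * x - 4) x := by
      have := (((hasDerivAt_pow 2 x).const_mul 5).sub ((hasDerivAt_id x).const_mul 4)).sub_const 1
      convert! this using 1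
      simp; ring
    have h2 : HasDerivAt (fun t : ℝ => 2 * t ^ 2 + 4 * t) (4 * x + 4) x := by
      have := ((hasDerivAt_pow 2 x).const_mul 2).add ((hasDerivAt_id x).const_mul 4)
      convert! this using 1
      simp; ring
    have h3 : (2 * x ^ 2 + 4 * x) ≠ 0 := by positivity
    convert! (Real.hasDerivAt_log hx.ne').sub (h1.div h2 h3) using 1
    have : x + 2 ≠ 0 := by positivity
    have : 2 * x ^ 2 + 4 * x = 2 * x * (x + 2) := by ring
    rw [this]
    field_simp
    ring
  have h1 : g 1 = 0 := by norm_num [hg]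
  suffices h : g 1 ≤ g t by
    rw [h1] at h
    simpa [hg] using h
  rcases le_total 1 t with h | h
  · refine monotoneOn_of_deriv_nonneg (convex_Ici 1) ?_ ?_ ?_ Set.self_mem_Ici h h
    · exact fun x hx => (hd x (by linarith [Set.mem_Ici.1 hx])).continuousAt.continuousWithinAt
    · intro x hx
      rw [interior_Ici, Set.mem_Ioi] at hx
      exact (hd x (by linarith)).differentiableAt.differentiableWithinAt
    · intro x hx
      rw [interior_Ici, Set.mem_Ioi] at hx
      rw [(hd x (by linarith)).deriv]
      have : 0 ≤ x - 1 := by linarith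
      positivity
  · refine antitoneOn_of_deriv_nonpos (convex_Icc t 1) ?_ ?_ ?_ ⟨le_rfl, h⟩ ⟨h, le_rfl⟩ h
    · exact fun x hx => (hd x (ht.trans_le hx.1)).continuousAt.continuousWithinAt
    · intro x hx
      rw [interior_Icc] at hx
      exact (hd x (ht.trans hx.1)).differentiableAt.differentiableWithinAt
    · intro x hx
      rw [interior_Icc] at hx
      have h0 := ht.trans hx.1
      rw [(hd x h0).deriv]
      have : x - 1 ≤ 0 := by linarith [hx.2]
      exact div_nonpos_of_nonpos_of_nonneg ((Odd.pow_nonpos_iff (by decide)).2 this) (by positivity)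

/-- The logarithm bound at `x / y`, multiplied by `x`. The weights `1/3, 2/3` are the ones for which
both sides agree to third order at `x = y`. -/
theorem Real.sq_sub_div_le_mul_log_sub {x y : ℝ} (hx : 0 < x) (hy : 0 < y) :
    (x - y) ^ 2 / ((x + 2 * y) / 3) ≤ 2 * (x * Real.log x - x * Real.log y - x + y) := by
  have h := Real.le_log_of_pos (div_pos hx hy)
  rw [Real.log_div hx.ne' hy.ne'] at h
  have h2 := mul_le_mul_of_nonneg_left h hx.le
  have : x * ((5 * (x / y) ^ 2 - 4 * (x / y) - 1) / (2 * (x / y) ^ 2 + 4 * (x / y)))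
      = (x - y) ^ 2 / ((x + 2 * y) / 3) / 2 + x - y := by
    field_simp
    ring
  rw [this] at h2
  linarith

/-! ### Traces in two eigenbases, relative entropy, exponential and logarithm -/

section MatrixTrace

open Matrix

variable {n : Type*} [Fintype n] [DecidableEq n]

theorem Matrix.trace_conj_diagonal_mul_mul (U V X : Matrix n n ℂ) (f g : n → ℂ) :
    (U * diagonal f * Uᴴ * X * (V * diagonal g * Vᴴ)).trace =
      ∑ i, ∑ j, f i * g j * ((Uᴴ * X * V) i j * star ((Uᴴ * V) i j)) := by
  have : (U * diagonal f * Uᴴ * X * (V * diagonal g * Vᴴ)).trace =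
      (diagonal f * (Uᴴ * X * V) * (diagonal g * (Uᴴ * V)ᴴ)).trace := by
    rw [conjTranspose_mul, conjTranspose_conjTranspose]
    simp only [mul_assoc]
    rw [trace_mul_comm U]
    simp only [mul_assoc]
  rw [this, trace]
  refine Finset.sum_congr rfl fun i _ => ?_
  rw [diag_apply, mul_apply]
  refine Finset.sum_congr rfl fun j _ => ?_
  rw [diagonal_mul, diagonal_mul, conjTranspose_apply]
  ring

theorem Matrix.IsHermitian.cfc_eq_mul {A : Matrix n n ℂ} (hA : A.IsHermitian) (f : ℝ → ℝ) :
    cfc f A = (hA.eigenvectorUnitary : Matrix n n ℂ) *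
      diagonal (fun i => ((f (hA.eigenvalues i) : ℝ) : ℂ)) *
      (hA.eigenvectorUnitary : Matrix n n ℂ)ᴴ := by
  rw [hA.cfc_eq, IsHermitian.cfc, Unitary.conjStarAlgAut_apply]
  rfl

theorem Matrix.IsHermitian.trace_cfc_mul_mul_cfc {A B : Matrix n n ℂ} (hA : A.IsHermitian)
    (hB : B.IsHermitian) (X : Matrix n n ℂ) (f g : ℝ → ℝ) :
    (cfc f A * X * cfc g B).trace = ∑ i, ∑ j, (f (hA.eigenvalues i) : ℂ) * (g (hB.eigenvalues j)) *
      (((hA.eigenvectorUnitary : Matrix n n ℂ)ᴴ * X * (hB.eigenvectorUnitary : Matrix n n ℂ)) i j *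
       star (((hA.eigenvectorUnitary : Matrix n n ℂ)ᴴ * (hB.eigenvectorUnitary : Matrix n n ℂ)) i j))
       := by
  rw [hA.cfc_eq_mul, hB.cfc_eq_mul, trace_conj_diagonal_mul_mul]

theorem Matrix.IsHermitian.trace_cfc_mul_cfc {A B : Matrix n n ℂ} (hA : A.IsHermitian)
    (hB : B.IsHermitian) (f g : ℝ → ℝ) :
    (cfc f A * cfc g B).trace.re = ∑ i, ∑ j, f (hA.eigenvalues i) * g (hB.eigenvalues j) *
      ‖((hA.eigenvectorUnitary : Matrix n n ℂ)ᴴ * (hB.eigenvectorUnitary : Matrix n n ℂ)) i j‖ ^ 2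
       := by
  have h := hA.trace_cfc_mul_mul_cfc hB 1 f g
  rw [mul_one, mul_one] at h
  rw [h, Complex.re_sum]
  refine Finset.sum_congr rfl fun i _ => ?_
  rw [Complex.re_sum]
  refine Finset.sum_congr rfl fun j _ => ?_
  rw [RCLike.star_def, Complex.mul_conj', ← Complex.ofReal_mul, ← Complex.ofReal_pow,
    ← Complex.ofReal_mul, Complex.ofReal_re]

theorem Matrix.IsHermitian.sum_eigenvalues_eq_one {A : Matrix n n ℂ} (hA : A.IsHermitian)
    (h : A.trace = 1) : ∑ i, hA.eigenvalues i = 1 := by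
  have := congrArg Complex.re hA.trace_eq_sum_eigenvalues
  rw [h, Complex.re_sum] at this
  exact this.symm

theorem Matrix.sum_norm_sq_row_of_mem_unitaryGroup {Y : Matrix n n ℂ} (hY : Y ∈ unitaryGroup n ℂ)
    (i : n) : ∑ j, ‖Y i j‖ ^ 2 = 1 := by
  have h := congrFun (congrFun (mem_unitaryGroup_iff.1 hY) i) i
  rw [mul_apply, one_apply_eq] at h
  have : ((∑ j, ‖Y i j‖ ^ 2 : ℝ) : ℂ) = 1 := by
    rw [← h]
    push_cast
    refine Finset.sum_congr rfl fun j _ => ?_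
    rw [star_apply, RCLike.star_def, RCLike.mul_conj]
    norm_cast
  exact_mod_cast this

theorem Matrix.sum_norm_sq_col_of_mem_unitaryGroup {Y : Matrix n n ℂ} (hY : Y ∈ unitaryGroup n ℂ)
    (j : n) : ∑ i, ‖Y i j‖ ^ 2 = 1 := by
  have h := sum_norm_sq_row_of_mem_unitaryGroup (Unitary.star_mem hY) j
  simpa [star_apply] using h

/-- A quantum Pinsker inequality for the expectation of a unitary observable. -/
theorem Matrix.PosDef.sq_trace_sub_le_two_mul_relEntropy {τ σ X : Matrix n n ℂ} (hτ : τ.PosDef)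
    (hσ : σ.PosDef) (hτ1 : τ.trace = 1) (hσ1 : σ.trace = 1) (hX : X ∈ unitaryGroup n ℂ) :
    ((σ * X).trace.re - (τ * X).trace.re) ^ 2 ≤
      2 * ((τ * cfc Real.log τ).trace.re - (τ * cfc Real.log σ).trace.re) := by
  set p := hτ.1.eigenvalues with hp
  set q := hσ.1.eigenvalues with hq
  set W := (hτ.1.eigenvectorUnitary : Matrix n n ℂ)ᴴ * (hσ.1.eigenvectorUnitary : Matrix n n ℂ)
    with hW
  set Y := (hτ.1.eigenvectorUnitary : Matrix n n ℂ)ᴴ * X * (hσ.1.eigenvectorUnitary : Matrix n n ℂ)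
    with hY
  have hWu : W ∈ unitaryGroup n ℂ :=
    mul_mem (Unitary.star_mem hτ.1.eigenvectorUnitary.2) hσ.1.eigenvectorUnitary.2
  have hYu : Y ∈ unitaryGroup n ℂ :=
    mul_mem (mul_mem (Unitary.star_mem hτ.1.eigenvectorUnitary.2) hX) hσ.1.eigenvectorUnitary.2
  have hp0 : ∀ i, 0 < p i := hτ.eigenvalues_pos
  have hq0 : ∀ i, 0 < q i := hσ.eigenvalues_pos
  have hp1 : ∑ i, p i = 1 := hτ.1.sum_eigenvalues_eq_one hτ1
  have hq1 : ∑ i, q i = 1 := hσ.1.sum_eigenvalues_eq_one hσ1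
  have rowsum : ∀ (f : n → ℝ) {Z : Matrix n n ℂ} (hZ : Z ∈ unitaryGroup n ℂ),
      ∑ i, ∑ j, f i * ‖Z i j‖ ^ 2 = ∑ i, f i := fun f Z hZ => by
    refine Finset.sum_congr rfl fun i _ => ?_
    rw [← Finset.mul_sum, sum_norm_sq_row_of_mem_unitaryGroup hZ, mul_one]
  have colsum : ∀ (f : n → ℝ) {Z : Matrix n n ℂ} (hZ : Z ∈ unitaryGroup n ℂ),
      ∑ i, ∑ j, f j * ‖Z i j‖ ^ 2 = ∑ i, f i := fun f Z hZ => by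
    rw [Finset.sum_comm]
    refine Finset.sum_congr rfl fun i _ => ?_
    rw [← Finset.mul_sum, sum_norm_sq_col_of_mem_unitaryGroup hZ, mul_one]
  have eτ : cfc (fun x : ℝ => x) τ = τ := cfc_id' ℝ τ hτ.1
  have eσ : cfc (fun x : ℝ => x) σ = σ := cfc_id' ℝ σ hσ.1
  have oτ : cfc (fun _ : ℝ => (1 : ℝ)) τ = 1 := cfc_const_one ℝ τ (ha := hτ.1)
  have oσ : cfc (fun _ : ℝ => (1 : ℝ)) σ = 1 := cfc_const_one ℝ σ (ha := hσ.1)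
  -- the relative entropy as a double sum
  have hS : (τ * cfc Real.log τ).trace.re - (τ * cfc Real.log σ).trace.re =
      ∑ i, ∑ j, (p i * Real.log (p i) - p i * Real.log (q j) - p i + q j) * ‖W i j‖ ^ 2 := by
    have h1 : (τ * cfc Real.log τ).trace.re = ∑ i, ∑ j, p i * Real.log (p i) * ‖W i j‖ ^ 2 := by
      have : τ * cfc Real.log τ = cfc (fun x => x * Real.log x) τ * cfc (fun _ => (1 : ℝ)) σ := by
        rw [oσ, mul_one, cfc_mul (fun x => x) Real.log τ
          (finite_real_spectrum.continuousOn _) (finite_real_spectrum.continuousOn _), eτ]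
      rw [this, hτ.1.trace_cfc_mul_cfc hσ.1]
      simp only [mul_one]
      rfl
    have h2 : (τ * cfc Real.log σ).trace.re = ∑ i, ∑ j, p i * Real.log (q j) * ‖W i j‖ ^ 2 := by
      have := hτ.1.trace_cfc_mul_cfc hσ.1 (fun x => x) Real.log
      rwa [eτ] at this
    -- The terms `-p i + q j` cancel in total because both traces are `1`; they make the scalar
    -- inequality applicable entry by entry.
    simp only [add_mul, sub_mul, Finset.sum_add_distrib, Finset.sum_sub_distrib]
    rw [h1, h2, rowsum p hWu, colsum q hWu, hp1, hq1]
    ring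
  -- the difference of expectations as a double sum
  have hD : (σ * X).trace.re - (τ * X).trace.re =
      ∑ i, ∑ j, (q j - p i) * (Y i j * star (W i j)).re := by
    have h1 : (τ * X).trace = ∑ i, ∑ j, (p i : ℂ) * (Y i j * star (W i j)) := by
      have := hτ.1.trace_cfc_mul_mul_cfc hσ.1 X (fun x => x) (fun _ => 1)
      rw [eτ, oσ] at this
      simpa using this
    have h2 : (σ * X).trace = ∑ i, ∑ j, (q j : ℂ) * (Y i j * star (W i j)) := by
      have := hτ.1.trace_cfc_mul_mul_cfc hσ.1 X (fun _ => 1) (fun x => x)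
      rw [eσ, oτ, one_mul, trace_mul_comm] at this
      simpa using this
    rw [h1, h2]
    simp only [Complex.re_sum, Complex.re_ofReal_mul, sub_mul, Finset.sum_sub_distrib]
  -- The denominators of the scalar inequality. Being affine in `p` and `q`, they have total weight
  -- `1` against the doubly stochastic matrix `‖Y i j‖ ^ 2`.
  set M : n → n → ℝ := fun i j => (p i + 2 * q j) / 3 with hM
  have hM0 : ∀ i j, 0 < M i j := fun i j => by
    have := hp0 i; have := hq0 j; simp only [hM]; positivity
  have hMY : ∑ i, ∑ j, M i j * ‖Y i j‖ ^ 2 = 1 := by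
    have : ∀ i j, M i j * ‖Y i j‖ ^ 2 = (p i / 3) * ‖Y i j‖ ^ 2 + (2 * q j / 3) * ‖Y i j‖ ^ 2 :=
      fun i j => by simp only [hM]; ring
    simp only [this, Finset.sum_add_distrib]
    rw [rowsum (fun i => p i / 3) hYu, colsum (fun j => 2 * q j / 3) hYu, ← Finset.sum_div,
      ← Finset.sum_div, ← Finset.mul_sum, hp1, hq1]
    norm_num
  rw [hS, hD]
  have hle : ∑ i, ∑ j, (p i - q j) ^ 2 / M i j * ‖W i j‖ ^ 2 ≤
      2 * ∑ i, ∑ j, (p i * Real.log (p i) - p i * Real.log (q j) - p i + q j) * ‖W i j‖ ^ 2 := by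
    rw [Finset.mul_sum]
    refine Finset.sum_le_sum fun i _ => ?_
    rw [Finset.mul_sum]
    refine Finset.sum_le_sum fun j _ => ?_
    rw [← mul_assoc]
    exact mul_le_mul_of_nonneg_right (Real.sq_sub_div_le_mul_log_sub (hp0 i) (hq0 j))
      (by positivity)
  refine le_trans ?_ hle
  -- Cauchy–Schwarz over pairs of eigenvectors: one factor is bounded by the entropy, the other sums
  -- to `1`.
  have hcs := Finset.sum_sq_le_sum_mul_sum_of_sq_le_mul (Finset.univ : Finset (n × n))
    (r := fun z => (q z.2 - p z.1) * (Y z.1 z.2 * star (W z.1 z.2)).re)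
    (f := fun z => (p z.1 - q z.2) ^ 2 / M z.1 z.2 * ‖W z.1 z.2‖ ^ 2)
    (g := fun z => M z.1 z.2 * ‖Y z.1 z.2‖ ^ 2)
    (fun z _ => by have := hM0 z.1 z.2; positivity)
    (fun z _ => by have := hM0 z.1 z.2; positivity)
    (fun z _ => by
      have h0 := hM0 z.1 z.2
      have h1 : (Y z.1 z.2 * star (W z.1 z.2)).re ^ 2 ≤ ‖Y z.1 z.2‖ ^ 2 * ‖W z.1 z.2‖ ^ 2 := by
        rw [← mul_pow, ← norm_star (W z.1 z.2), ← norm_mul]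
        exact sq_le_sq.2 ((Complex.abs_re_le_norm _).trans (le_abs_self _))
      calc _ = (p z.1 - q z.2) ^ 2 * (Y z.1 z.2 * star (W z.1 z.2)).re ^ 2 := by ring
        _ ≤ (p z.1 - q z.2) ^ 2 * (‖Y z.1 z.2‖ ^ 2 * ‖W z.1 z.2‖ ^ 2) := by gcongr
        _ = _ := by field_simp)
  simp only [Fintype.sum_prod_type] at hcs
  rwa [hMY, mul_one] at hcs

/-- Eigenvalues of a state are at most `1`, so their logarithms are nonpositive. This caps the
potential. -/
theorem Matrix.PosSemidef.trace_mul_log_nonpos {ρ σ : Matrix n n ℂ} (hρ : ρ.PosSemidef)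
    (hσ : σ.PosDef) (hσ1 : σ.trace = 1) : (ρ * cfc Real.log σ).trace.re ≤ 0 := by
  have eρ : cfc (fun x : ℝ => x) ρ = ρ := cfc_id' ℝ ρ hρ.1
  have h := hρ.1.trace_cfc_mul_cfc hσ.1 (fun x => x) Real.log
  rw [eρ] at h
  rw [h]
  refine Finset.sum_nonpos fun i _ => Finset.sum_nonpos fun j _ => ?_
  refine mul_nonpos_of_nonpos_of_nonneg (mul_nonpos_of_nonneg_of_nonpos (hρ.eigenvalues_nonneg i)
    (Real.log_nonpos (hσ.eigenvalues_pos j).le ?_)) (by positivity)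
  rw [← hσ.1.sum_eigenvalues_eq_one hσ1]
  exact Finset.single_le_sum (fun k _ => (hσ.eigenvalues_pos k).le) (Finset.mem_univ j)

theorem Matrix.IsHermitian.exp_eq_cfc {G : Matrix n n ℂ} (hG : G.IsHermitian) :
    NormedSpace.exp G = cfc Real.exp G := by
  set U := (hG.eigenvectorUnitary : Matrix n n ℂ) with hU
  have h1 : U * Uᴴ = 1 := Unitary.mul_star_self_of_mem hG.eigenvectorUnitary.2
  have hinv : U⁻¹ = Uᴴ := inv_eq_right_inv h1
  have hu : IsUnit U := IsUnit.of_mul_eq_one _ h1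
  have e : cfc (fun x : ℝ => x) G = G := cfc_id' ℝ G hG
  conv_lhs => rw [← e]
  rw [hG.cfc_eq_mul, hG.cfc_eq_mul, ← hU, ← hinv, exp_conj _ _ hu, exp_diagonal]
  congr 3
  ext i
  rw [Pi.coe_exp, Complex.ofReal_exp, Complex.exp_eq_exp_ℂ]

theorem Matrix.IsHermitian.posDef_exp {G : Matrix n n ℂ} (hG : G.IsHermitian) :
    (NormedSpace.exp G).PosDef := by
  set U := (hG.eigenvectorUnitary : Matrix n n ℂ) with hU
  have h1 : U * Uᴴ = 1 := Unitary.mul_star_self_of_mem hG.eigenvectorUnitary.2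
  rw [hG.exp_eq_cfc, hG.cfc_eq_mul, ← hU]
  refine PosDef.mul_mul_conjTranspose_same (posDef_diagonal_iff.2 fun i => ?_) ?_
  · exact_mod_cast Real.exp_pos _
  · intro v w hvw
    have : v ᵥ* (U * Uᴴ) = w ᵥ* (U * Uᴴ) := by
      rw [← vecMul_vecMul, ← vecMul_vecMul]; exact congrArg (· ᵥ* Uᴴ) hvw
    simpa [h1] using this

/-- Normalising the exponential shifts its logarithm only by a scalar, so the logarithm of an update
is explicit. -/
theorem Matrix.IsHermitian.log_smul_exp {G : Matrix n n ℂ} (hG : G.IsHermitian) {c : ℝ}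
    (hc : 0 < c) :
    cfc Real.log (c • NormedSpace.exp G) = G + Real.log c • (1 : Matrix n n ℂ) := by
  have hf : ∀ f : ℝ → ℝ, ContinuousOn f (spectrum ℝ G) :=
    fun f => finite_real_spectrum.continuousOn f
  have hs : IsSelfAdjoint G := hG
  rw [hG.exp_eq_cfc, ← cfc_smul c Real.exp G (hf _)]
  have := cfc_comp' Real.log (fun x => c • Real.exp x) G
    ((finite_real_spectrum.image _).continuousOn _) (hf _) hs
  rw [← this]
  have h2 : (fun x => Real.log (c • Real.exp x)) = fun x => x + Real.log c := by
    ext x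
    rw [smul_eq_mul, Real.log_mul hc.ne' (Real.exp_pos x).ne', Real.log_exp, add_comm]
  rw [h2, cfc_add_const _ _ _ (hf _) hs, cfc_id' ℝ G hs, Algebra.algebraMap_eq_smul_one]

end MatrixTrace

/-! ### Pauli operators as an orthogonal basis -/

section PauliOperators

open Matrix

variable {m : ℕ}

theorem pauli_isHermitian (i : Fin 4) : (pauli i).IsHermitian := by
  ext a b
  fin_cases i <;> fin_cases a <;> fin_cases b <;> simp [pauli]

theorem pauli_mul_self (i : Fin 4) : pauli i * pauli i = 1 := by
  ext a b
  fin_cases i <;> fin_cases a <;> fin_cases b <;> simp [pauli, mul_apply]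

/-- Entrywise form of `∑ P ⊗ P = 2 · SWAP`; taking products over qubits gives completeness. -/
theorem sum_pauli_mul_pauli (a b c d : Fin 2) :
    ∑ i, pauli i a b * pauli i c d = if a = d ∧ b = c then 2 else 0 := by
  rw [Fin.sum_univ_four]
  fin_cases a <;> fin_cases b <;> fin_cases c <;> fin_cases d <;> simp [pauli] <;> norm_num

theorem pauliOp_isHermitian (p : Fin m → Fin 4) : (pauliOp p).IsHermitian := by
  ext a b
  rw [conjTranspose_apply, pauliOp, of_apply, of_apply, star_prod]
  exact Finset.prod_congr rfl fun k _ => (pauli_isHermitian (p k)).apply _ _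

theorem pauliOp_mul_self (p : Fin m → Fin 4) : pauliOp p * pauliOp p = 1 := by
  ext a c
  rw [mul_apply]
  simp only [pauliOp, of_apply, ← Finset.prod_mul_distrib]
  rw [← Fintype.prod_sum fun k j => pauli (p k) (a k) j * pauli (p k) j (c k)]
  have : ∀ k, ∑ j, pauli (p k) (a k) j * pauli (p k) j (c k) = if a k = c k then 1 else 0 :=
    fun k => by rw [← mul_apply, pauli_mul_self, one_apply]
  simp only [this, one_apply]
  rw [Fintype.prod_ite_zero]
  simp [funext_iff]

theorem pauliOp_mem_unitaryGroup (p : Fin m → Fin 4) :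
    pauliOp p ∈ unitaryGroup (Fin m → Fin 2) ℂ := by
  rw [mem_unitaryGroup_iff, star_eq_conjTranspose, (pauliOp_isHermitian p).eq, pauliOp_mul_self]

theorem pauliOp_zero : pauliOp (0 : Fin m → Fin 4) = 1 := by
  ext a b
  have : ∀ k, pauli ((0 : Fin m → Fin 4) k) (a k) (b k) = if a k = b k then 1 else 0 :=
    fun k => by simp [pauli, one_apply]
  simp only [pauliOp, of_apply, this, one_apply]
  rw [Fintype.prod_ite_zero]
  simp [funext_iff]

theorem sum_pauliOp_mul_pauliOp (a b c d : Fin m → Fin 2) :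
    ∑ p, pauliOp p a b * pauliOp p c d = if a = d ∧ b = c then 2 ^ m else 0 := by
  simp only [pauliOp, of_apply, ← Finset.prod_mul_distrib]
  rw [← Fintype.prod_sum fun k j => pauli j (a k) (b k) * pauli j (c k) (d k)]
  simp only [sum_pauli_mul_pauli]
  rw [Fintype.prod_ite_zero]
  simp [funext_iff, forall_and]

/-- Completeness of the Pauli operators. -/
theorem sum_trace_mul_pauliOp_sq (A : QubitOp m) :
    ∑ p, (A * pauliOp p).trace ^ 2 = 2 ^ m * (A * A).trace := by
  have h : ∀ p : Fin m → Fin 4, (A * pauliOp p).trace ^ 2 =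
      ∑ a, ∑ b, ∑ c, ∑ d, A a b * A c d * (pauliOp p b a * pauliOp p d c) := fun p => by
    simp only [trace, diag_apply, mul_apply, sq, Finset.sum_mul, Finset.mul_sum]
    refine Finset.sum_congr rfl fun a _ => Finset.sum_congr rfl fun b _ =>
      Finset.sum_congr rfl fun c _ => Finset.sum_congr rfl fun d _ => by ring
  simp only [h]
  rw [Finset.sum_comm]
  simp only [trace, diag_apply, mul_apply, Finset.mul_sum]
  refine Finset.sum_congr rfl fun a _ => ?_
  rw [Finset.sum_comm]
  refine Finset.sum_congr rfl fun b _ => ?_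
  rw [Finset.sum_comm, Finset.sum_eq_single b, Finset.sum_comm, Finset.sum_eq_single a]
  · rw [← Finset.mul_sum, sum_pauliOp_mul_pauliOp, if_pos ⟨rfl, rfl⟩, mul_comm]
  · intro d _ hd
    rw [← Finset.mul_sum, sum_pauliOp_mul_pauliOp, if_neg fun h => hd h.2.symm, mul_zero]
  · simp
  · intro c _ hc
    rw [Finset.sum_comm]
    refine Finset.sum_eq_zero fun d _ => ?_
    rw [← Finset.mul_sum, sum_pauliOp_mul_pauliOp, if_neg fun h => hc h.1.symm, mul_zero]
  · simp

theorem frobeniusNorm_sq (A : QubitOp m) : frobeniusNorm A ^ 2 = ∑ i, ∑ j, ‖A i j‖ ^ 2 := by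
  rw [frobeniusNorm, frobenius_norm_def, ← Real.sqrt_eq_rpow, Real.sq_sqrt (by positivity)]
  norm_cast

theorem Matrix.IsHermitian.trace_mul_self {n : Type*} [Fintype n] {A : Matrix n n ℂ}
    (hA : A.IsHermitian) : (A * A).trace = ((∑ i, ∑ j, ‖A i j‖ ^ 2 : ℝ) : ℂ) := by
  push_cast
  rw [trace]
  refine Finset.sum_congr rfl fun i _ => ?_
  rw [diag_apply, mul_apply]
  refine Finset.sum_congr rfl fun j _ => ?_
  rw [← hA.apply j i, RCLike.star_def, Complex.mul_conj']

theorem Matrix.IsHermitian.ofReal_re_trace_mul {n : Type*} [Fintype n] {A B : Matrix n n ℂ}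
    (hA : A.IsHermitian) (hB : B.IsHermitian) : (((A * B).trace.re : ℝ) : ℂ) = (A * B).trace := by
  rw [← Complex.conj_eq_iff_re, ← RCLike.star_def, ← trace_conjTranspose, conjTranspose_mul, hA.eq,
    hB.eq, trace_mul_comm]

/-- The identity label can be dropped from the completeness relation because it contributes `tr A =
0`. -/
theorem sum_re_trace_mul_pauliOp_sq {A : QubitOp m} (hA : A.IsHermitian) (hA0 : A.trace = 0) :
    ∑ p : NonIdPauli m, (A * pauliOp p.1).trace.re ^ 2 = 2 ^ m * frobeniusNorm A ^ 2 := by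
  have h : ∑ p : Fin m → Fin 4, (A * pauliOp p).trace.re ^ 2 = 2 ^ m * frobeniusNorm A ^ 2 := by
    have h1 := sum_trace_mul_pauliOp_sq A
    rw [hA.trace_mul_self, ← frobeniusNorm_sq, Finset.sum_congr rfl fun p _ => by
      rw [← hA.ofReal_re_trace_mul (pauliOp_isHermitian p)]] at h1
    exact_mod_cast h1
  rw [← h, ← Fintype.sum_subtype_add_sum_subtype (fun p : Fin m → Fin 4 => p ≠ 0)]
  refine (add_eq_left.2 (Finset.sum_eq_zero fun p _ => ?_)).symm
  rw [not_not.1 p.2, pauliOp_zero, mul_one, hA0, Complex.zero_re, sq, mul_zero]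

end PauliOperators

/-! ### Progress of one update and the pathwise error bound -/

section MegStep

open Matrix

variable {m : ℕ}

theorem megExponent_isHermitian (η : ℝ) (σ : QubitOp m) {X : QubitOp m} (hX : X.IsHermitian)
    (y : ℝ) : (megExponent η σ X y).IsHermitian :=
  IsHermitian.sub (cfc_predicate Real.log σ : IsSelfAdjoint _)
    (hX.smul (k := 2 * η * ((σ * X).trace.re - y)) (IsSelfAdjoint.all _))

theorem megUpdate_eq_smul {η : ℝ} {σ X : QubitOp m} (hX : X.IsHermitian) (y : ℝ) :
    ∃ c : ℝ, 0 < c ∧ megUpdate η σ X y = c • NormedSpace.exp (megExponent η σ X y) ∧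
      (megUpdate η σ X y).trace = 1 := by
  have hp := (megExponent_isHermitian η σ hX y).posDef_exp
  have ht : 0 < (NormedSpace.exp (megExponent η σ X y)).trace := hp.trace_pos
  obtain ⟨h1, h2⟩ := Complex.lt_def.1 ht
  have he : ((NormedSpace.exp (megExponent η σ X y)).trace.re : ℂ) =
      (NormedSpace.exp (megExponent η σ X y)).trace := Complex.ext rfl h2
  refine ⟨(NormedSpace.exp (megExponent η σ X y)).trace.re⁻¹, inv_pos.2 h1, ?_, ?_⟩
  · rw [megUpdate, ← he, ← Complex.ofReal_inv, Complex.ofReal_re, Complex.coe_smul]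
  · rw [megUpdate, trace_smul, smul_eq_mul, inv_mul_cancel₀ ht.ne']

theorem megUpdate_posDef {η : ℝ} {σ X : QubitOp m} (hX : X.IsHermitian) (y : ℝ) :
    (megUpdate η σ X y).PosDef := by
  obtain ⟨c, hc, h, -⟩ := megUpdate_eq_smul (η := η) (σ := σ) hX y
  rw [h]
  exact (megExponent_isHermitian η σ hX y).posDef_exp.smul hc

theorem trace_megUpdate {η : ℝ} {σ X : QubitOp m} (hX : X.IsHermitian) (y : ℝ) :
    (megUpdate η σ X y).trace = 1 :=
  (megUpdate_eq_smul hX y).choose_spec.2.2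

/-- Each step increases `tr (ρ log σ)` by at least a multiple of the squared prediction error. -/
theorem le_trace_mul_log_megUpdate_sub (η : ℝ) {ρ σ X : QubitOp m} (hρ1 : ρ.trace = 1)
    (hσ : σ.PosDef) (hσ1 : σ.trace = 1) (hX : X.IsHermitian)
    (hXu : X ∈ unitaryGroup (Fin m → Fin 2) ℂ) :
    2 * η * (1 - η) * ((σ * X).trace.re - (ρ * X).trace.re) ^ 2 ≤
      (ρ * cfc Real.log (megUpdate η σ X (ρ * X).trace.re)).trace.re -
        (ρ * cfc Real.log σ).trace.re := by
  obtain ⟨c, hc, h, h1⟩ := megUpdate_eq_smul (η := η) (σ := σ) hX (ρ * X).trace.re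
  have hpin := (megUpdate_posDef (η := η) (σ := σ) hX
    (ρ * X).trace.re).sq_trace_sub_le_two_mul_relEntropy hσ h1 hσ1 hXu
  have hlog : cfc Real.log (megUpdate η σ X (ρ * X).trace.re) =
      cfc Real.log σ - (2 * η * ((σ * X).trace.re - (ρ * X).trace.re)) • X +
        Real.log c • (1 : QubitOp m) := by
    rw [h, (megExponent_isHermitian η σ hX _).log_smul_exp hc]
    rfl
  have key : ∀ τ : QubitOp m, τ.trace = 1 →
      (τ * cfc Real.log (megUpdate η σ X (ρ * X).trace.re)).trace.re =
        (τ * cfc Real.log σ).trace.re -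
          (2 * η * ((σ * X).trace.re - (ρ * X).trace.re)) * (τ * X).trace.re + Real.log c := by
    intro τ hτ
    rw [hlog, mul_add, mul_sub, mul_smul_comm, mul_smul_comm, trace_add, trace_sub, trace_smul,
      trace_smul, mul_one, hτ, Complex.add_re, Complex.sub_re, Complex.smul_re, Complex.smul_re]
    simp
  rw [key ρ hρ1]
  rw [key _ h1] at hpin
  set s' := (megUpdate η σ X (ρ * X).trace.re * X).trace.re
  set s := (σ * X).trace.re
  set y := (ρ * X).trace.re
  -- Eliminating `log c`, the gain is at least `(s'-s)²/2 + 2η(s-y)(s'-y)`; completing the square in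
  -- `s' - s` leaves `2η(1-η)(s-y)²`.
  nlinarith [sq_nonneg (s' - s + 2 * η * (s - y))]

variable {η : ℝ} {ρ σ : QubitOp m}

theorem megEstimate_posDef (hσ : σ.PosDef) (x : ℕ → NonIdPauli m) (t : ℕ) :
    (megEstimate η ρ σ x t).PosDef := by
  cases t with
  | zero => exact hσ
  | succ t => exact megUpdate_posDef (pauliOp_isHermitian _) _

theorem trace_megEstimate (hσ : σ.trace = 1) (x : ℕ → NonIdPauli m) (t : ℕ) :
    (megEstimate η ρ σ x t).trace = 1 := by
  cases t with
  | zero => exact hσ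
  | succ t => exact trace_megUpdate (pauliOp_isHermitian _) _

/-- The gains in potential telescope, and the final potential is at most `0`. -/
theorem sum_sq_prediction_error_le (hη0 : 0 < η) (hη : η < 1) (hρ : IsState ρ) (hσ : σ.PosDef)
    (hσ1 : σ.trace = 1) (x : ℕ → NonIdPauli m) (T : ℕ) :
    ∑ t ∈ Finset.range T, ((megEstimate η ρ σ x t - ρ) * pauliOp (x t).1).trace.re ^ 2 ≤
      -(ρ * cfc Real.log σ).trace.re / (2 * η * (1 - η)) := by
  have hc : 0 < 2 * η * (1 - η) := by nlinarith
  rw [le_div_iff₀' hc, Finset.mul_sum]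
  have h : ∀ t ∈ Finset.range T,
      2 * η * (1 - η) * ((megEstimate η ρ σ x t - ρ) * pauliOp (x t).1).trace.re ^ 2 ≤
      (ρ * cfc Real.log (megEstimate η ρ σ x (t + 1))).trace.re -
        (ρ * cfc Real.log (megEstimate η ρ σ x t)).trace.re := fun t _ => by
    rw [sub_mul, trace_sub, Complex.sub_re]
    exact le_trace_mul_log_megUpdate_sub η hρ.2 (megEstimate_posDef hσ x t)
      (trace_megEstimate hσ1 x t) (pauliOp_isHermitian _) (pauliOp_mem_unitaryGroup _)
  refine (Finset.sum_le_sum h).trans ?_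
  rw [Finset.sum_range_sub fun t => (ρ * cfc Real.log (megEstimate η ρ σ x t)).trace.re]
  have := hρ.1.trace_mul_log_nonpos (megEstimate_posDef (η := η) (ρ := ρ) hσ x T)
    (trace_megEstimate hσ1 x T)
  change _ - (ρ * cfc Real.log σ).trace.re ≤ _
  linarith

theorem megEstimate_congr {x x' : ℕ → NonIdPauli m} {t : ℕ} (h : ∀ s < t, x s = x' s) :
    megEstimate η ρ σ x t = megEstimate η ρ σ x' t := by
  induction t with
  | zero => rfl
  | succ t ih =>
    rw [megEstimate, megEstimate, ih fun s hs => h s (hs.trans t.lt_succ_self), h t t.lt_succ_self]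

end MegStep

/-! ### Averaging over the random measurements -/

section Convergence

variable {m : ℕ} {Ω : Type*} {η : ℝ} {ρ σ : QubitOp m} {x : ℕ → Ω → NonIdPauli m}

/-- Factoring through a finite type makes measurability and integrability automatic, and gives
independence from `x t`. -/
theorem exists_megEstimate_eq_comp_restrict [Nonempty (NonIdPauli m)] (t : ℕ) :
    ∃ g : (Finset.range t → NonIdPauli m) → QubitOp m, ∀ ω,
      megEstimate η ρ σ (fun s => x s ω) t = g fun s => x s ω := by
  classical
  -- Labels from step `t` on are arbitrary: the estimate at `t` reads only earlier ones.
  refine ⟨fun z => megEstimate η ρ σ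
    (fun s => if h : s ∈ Finset.range t then z ⟨s, h⟩ else Classical.arbitrary _) t, fun ω => ?_⟩
  exact megEstimate_congr fun s hs => by rw [dif_pos (Finset.mem_range.2 hs)]

variable [MeasurableSpace Ω] {μ : Measure Ω}

theorem measurable_comp_megEstimate [Nonempty (NonIdPauli m)] (hxm : ∀ t, Measurable (x t))
    (t : ℕ) (f : QubitOp m → ℝ) :
    Measurable fun ω => f (megEstimate η ρ σ (fun s => x s ω) t) := by
  obtain ⟨g, hg⟩ := exists_megEstimate_eq_comp_restrict (η := η) (ρ := ρ) (σ := σ) (x := x) t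
  simp only [hg]
  exact (measurable_of_finite fun z => f (g z)).comp (measurable_pi_lambda _ fun s => hxm s)

theorem integrable_comp_megEstimate [Nonempty (NonIdPauli m)] [IsFiniteMeasure μ]
    (hxm : ∀ t, Measurable (x t)) (t : ℕ) (f : QubitOp m → NonIdPauli m → ℝ) :
    Integrable (fun ω => f (megEstimate η ρ σ (fun s => x s ω) t) (x t ω)) μ := by
  obtain ⟨g, hg⟩ := exists_megEstimate_eq_comp_restrict (η := η) (ρ := ρ) (σ := σ) (x := x) t
  simp only [hg]
  have h : Measurable fun ω => ((fun s : Finset.range t => x s ω), x t ω) :=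
    (measurable_pi_lambda (fun ω (s : Finset.range t) => x s ω) fun s => hxm s).prodMk (hxm t)
  exact (Integrable.of_finite (f := fun z : (Finset.range t → NonIdPauli m) × NonIdPauli m =>
    f (g z.1) z.2) (μ := μ.map _)).comp_measurable h

/-- The next measurement is independent of the current estimate. -/
theorem integral_megEstimate_next [Nonempty (NonIdPauli m)] [IsProbabilityMeasure μ]
    (hxm : ∀ t, Measurable (x t)) (hxi : iIndepFun x μ)
    (hxu : ∀ t, μ.map (x t) = uniformOn Set.univ) (t : ℕ) (f : QubitOp m → NonIdPauli m → ℝ) :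
    ∫ ω, f (megEstimate η ρ σ (fun s => x s ω) t) (x t ω) ∂μ =
      (Fintype.card (NonIdPauli m) : ℝ)⁻¹ *
        ∫ ω, ∑ p, f (megEstimate η ρ σ (fun s => x s ω) t) p ∂μ := by
  classical
  obtain ⟨g, hg⟩ := exists_megEstimate_eq_comp_restrict (η := η) (ρ := ρ) (σ := σ) (x := x) t
  have hind : IndepFun (fun ω (s : Finset.range t) => x s ω) (x t) μ :=
    (hxi.indepFun_finset (Finset.range t) {t} (by simp) hxm).comp measurable_id
      (measurable_pi_apply (⟨t, Finset.mem_singleton_self t⟩ : ({t} : Finset ℕ)))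
  have hmeas : Measurable fun ω (s : Finset.range t) => x s ω :=
    measurable_pi_lambda _ fun s => hxm s
  have hprob : ∀ p, ∫ ω, (if x t ω = p then (1 : ℝ) else 0) ∂μ =
      (Fintype.card (NonIdPauli m) : ℝ)⁻¹ := fun p => by
    have h1 : μ (x t ⁻¹' {p}) = (Fintype.card (NonIdPauli m) : ENNReal)⁻¹ := by
      rw [← Measure.map_apply (hxm t) (measurableSet_singleton p), hxu, uniformOn_univ]
      simp
    have h2 := integral_indicator_one (μ := μ) (hxm t (measurableSet_singleton p))
    rw [Measure.real, h1, ENNReal.toReal_inv, ENNReal.toReal_natCast] at h2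
    rw [← h2]
    congr 1
    ext ω
    simp only [Set.indicator_apply, Set.mem_preimage, Set.mem_singleton_iff, Pi.one_apply]
  -- Splitting by the value of `x t` turns each term into a product of a function of the past and a
  -- function of `x t`, so the expectation factors.
  have hsplit : ∀ ω, f (g fun s => x s ω) (x t ω) =
      ∑ p, f (g fun s => x s ω) p * (if x t ω = p then 1 else 0) := fun ω => by simp
  have hint : ∀ p, Integrable (fun ω => f (g fun s => x s ω) p) μ := fun p =>
    (Integrable.of_finite (f := fun z => f (g z) p) (μ := μ.map _)).comp_measurable hmeas
  simp only [hg, hsplit]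
  rw [integral_finsetSum _ fun p _ => ?_, integral_finsetSum _ fun p _ => hint p, Finset.mul_sum]
  · refine Finset.sum_congr rfl fun p _ => ?_
    have := (hind.comp (measurable_of_finite fun z => f (g z) p)
      (measurable_of_finite fun q => if q = p then (1 : ℝ) else 0)).integral_fun_mul_eq_mul_integral
      ((measurable_of_finite fun z => f (g z) p).comp hmeas).aestronglyMeasurable
      ((measurable_of_finite fun q => if q = p then (1 : ℝ) else 0).comp
        (hxm t)).aestronglyMeasurable
    simp only [Function.comp_def] at this
    rw [this, hprob, mul_comm]
  · have := integrable_comp_megEstimate (μ := μ) (η := η) (ρ := ρ) (σ := σ) hxm t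
      fun A q => f A p * if q = p then 1 else 0
    simpa only [hg] using this

theorem summable_integral_frobeniusNorm_sq [Nonempty (NonIdPauli m)] [IsProbabilityMeasure μ]
    (hρ : IsState ρ) (hσ : σ.PosDef) (hσ1 : σ.trace = 1) (hη0 : 0 < η) (hη : η < 1)
    (hxm : ∀ t, Measurable (x t)) (hxi : iIndepFun x μ)
    (hxu : ∀ t, μ.map (x t) = uniformOn Set.univ) :
    Summable fun t =>
      ∫ ω, frobeniusNorm (megEstimate η ρ σ (fun s => x s ω) t - ρ) ^ 2 ∂μ := by
  have hstep : ∀ t, ∫ ω, ((megEstimate η ρ σ (fun s => x s ω) t - ρ) *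
      pauliOp (x t ω).1).trace.re ^ 2 ∂μ = (Fintype.card (NonIdPauli m) : ℝ)⁻¹ * (2 ^ m *
        ∫ ω, frobeniusNorm (megEstimate η ρ σ (fun s => x s ω) t - ρ) ^ 2 ∂μ) := fun t => by
    rw [integral_megEstimate_next hxm hxi hxu t fun A p => ((A - ρ) * pauliOp p.1).trace.re ^ 2,
      ← integral_const_mul (2 ^ m : ℝ)]
    congr 1
    refine integral_congr_ae (Eventually.of_forall fun ω => ?_)
    refine sum_re_trace_mul_pauliOp_sq ((megEstimate_posDef hσ _ t).1.sub hρ.1.1) ?_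
    rw [Matrix.trace_sub, trace_megEstimate hσ1, hρ.2, sub_self]
  have hcard : (0 : ℝ) < (Fintype.card (NonIdPauli m) : ℝ)⁻¹ * 2 ^ m := by
    have : 0 < Fintype.card (NonIdPauli m) := Fintype.card_pos
    positivity
  refine (summable_mul_left_iff hcard.ne').1 ?_
  simp only [mul_assoc, ← hstep]
  refine summable_of_sum_range_le (c := -(ρ * cfc Real.log σ).trace.re / (2 * η * (1 - η)))
    (fun t => integral_nonneg fun ω => sq_nonneg _) fun T => ?_
  have hI := fun t => integrable_comp_megEstimate (μ := μ) (η := η) (ρ := ρ) (σ := σ) hxm t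
    fun A p => ((A - ρ) * pauliOp p.1).trace.re ^ 2
  rw [← integral_finsetSum _ fun t _ => hI t]
  refine (integral_mono (integrable_finsetSum _ fun t _ => hI t) (integrable_const _)
    fun ω => sum_sq_prediction_error_le hη0 hη hρ hσ hσ1 (fun s => x s ω) T).trans ?_
  simp

end Convergence

theorem mainTheorem3 {m : ℕ} (hm : 1 ≤ m)
    {Ω : Type*} [MeasurableSpace Ω] (μ : Measure Ω) [IsProbabilityMeasure μ]
    (ρ σ : QubitOp m) (hρ : IsState ρ) (hσ : IsState σ) (hσpos : σ.PosDef)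
    (η : ℝ) (hη0 : 0 < η) (hη : η < 1 / 2)
    (x : ℕ → Ω → NonIdPauli m) (hxm : ∀ t, Measurable (x t)) (hxi : iIndepFun x μ)
    (hxu : ∀ t, μ.map (x t) = uniformOn Set.univ) :
    ∀ δ : ℝ, 0 < δ →
      Tendsto
        (fun t : ℕ => μ {ω | frobeniusNorm (megEstimate η ρ σ (fun s => x s ω) t - ρ) ^ 2 < δ})
        atTop (𝓝 1) := by
  intro δ hδ
  obtain ⟨ω₀⟩ := nonempty_of_isProbabilityMeasure μ
  have : Nonempty (NonIdPauli m) := ⟨x 0 ω₀⟩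
  set F : ℕ → Ω → ℝ := fun t ω => frobeniusNorm (megEstimate η ρ σ (fun s => x s ω) t - ρ) ^ 2
    with hF
  have hFm : ∀ t, Measurable (F t) := fun t =>
    measurable_comp_megEstimate hxm t fun A => frobeniusNorm (A - ρ) ^ 2
  have hFi : ∀ t, Integrable (F t) μ := fun t =>
    integrable_comp_megEstimate hxm t fun A _ => frobeniusNorm (A - ρ) ^ 2
  have hlim : Tendsto (fun t => ∫ ω, F t ω ∂μ) atTop (𝓝 0) :=
    (summable_integral_frobeniusNorm_sq hρ hσpos hσ.2 hη0 (by linarith) hxm hxi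
      hxu).tendsto_atTop_zero
  -- Markov's inequality.
  have hbad : Tendsto (fun t => μ.real {ω | δ ≤ F t ω}) atTop (𝓝 0) := by
    refine squeeze_zero (fun t => measureReal_nonneg) (fun t => ?_)
      (by simpa using hlim.div_const δ)
    rw [le_div_iff₀' hδ]
    exact mul_meas_ge_le_integral_of_nonneg (Eventually.of_forall fun ω => sq_nonneg _) (hFi t) δ
  have hgood : Tendsto (fun t => μ.real {ω | F t ω < δ}) atTop (𝓝 1) := by
    have h : ∀ t, μ.real {ω | F t ω < δ} = 1 - μ.real {ω | δ ≤ F t ω} := fun t => by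
      rw [← probReal_compl_eq_one_sub (measurableSet_le measurable_const (hFm t))]
      congr 1
      ext ω
      simp
    simp only [h]
    simpa using hbad.const_sub 1
  have := ENNReal.tendsto_ofReal hgood
  simpa using this
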